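/- Let $d\ge 1$, let $R\subset\mathbb Z^d$ be a finite nonempty set of steps, let $G$ be the additive subgroup of $\mathbb Z^d$ generated by $R$, and let $U\subset\mathbb R^d$ be the convex hull of $R$. Let $(X_n)_{n\ge 0}$ be the random walk started at $X_0=0$ whose steps $Z_k=X_k-X_{k-1}$, $k\ge 1$, are i.i.d. uniform on $R$, and let $E$ denote expectation with respect to this walk. Let $(\Omega,\mathfrak S,\mathbb P)$ be a probability space with a group $\{T_x:x\in G\}$ of measurable transformations of $\Omega$ such that $T_0$ is the identity, $T_{x+y}=T_xT_y$, and $\mathbb P$ is $T_x$-invariant for every $x\in G$ (no ergodicity is assumed). Let $\ell\ge 0$ be an integer and let $g:\Omega\times R^\ell\to\mathbb R$ satisfy $g(\cdot,z_{1,\ell})\in L^1(\mathbb P)$ for each $z_{1,\ell}=(z_1,\dots,z_\ell)\in R^\ell$. Then for $\mathbb P$-almost every $\omega$ and simultaneously for all $\xi\in U\cap\mathbb Q^d$ the following holds: for every path $(y_n)_{n\ge 0}$ in $\mathbb Z^d$ such that $y_n-y_{n-1}\in R$ for all $n\ge 1$ and such that, for some integer $k\ge 1$, $y_{mk}=mk\xi$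 for all integers $m\ge 0$, the limit $$\Lambda_\ell(g,\xi;\omega)=\lim_{n\to\infty}\frac1n\log E\Big[e^{\sum_{j=0}^{n-1}g(T_{X_j}\omega,\,(Z_{j+1},\dots,Z_{j+\ell}))}\,\mathbf 1\{X_n=y_n\}\Big]$$ exists in $(-\infty,\infty]$. For a given $\xi$ (and $\omega$) the limit does not depend on the choice of the path $(y_n)$ (nor on $k$) subject to these conditions. -/

import Mathlib

open MeasureTheory Filter Topology

noncomputable section

/-- The additive group generated by the finite step set `R ⊂ ℤ^d`. -/
abbrev stepGroup {d : ℕ} (R : Finset (Fin d → ℤ)) : AddSubgroup (Fin d → ℤ) :=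
  AddSubgroup.closure (R : Set (Fin d → ℤ))

/-- The convex hull in `ℝ^d` of the step set. -/
def stepHull {d : ℕ} (R : Finset (Fin d → ℤ)) : Set (Fin d → ℝ) :=
  convexHull ℝ ((fun (z : Fin d → ℤ) (i : Fin d) => (z i : ℝ)) '' (R : Set (Fin d → ℤ)))

/-- The law of the i.i.d. steps of the random walk, each uniform on `R`. The coordinate
`z i` of a sample point `z : ℕ → R` is the step from time `i` to time `i + 1`. -/
def stepLaw {d : ℕ} (R : Finset (Fin d → ℤ)) [Nonempty R] : Measure (ℕ → R) :=
  Measure.infinitePi fun _ : ℕ => (PMF.uniformOfFintype R).toMeasure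

/-- The position at time `n` of the walk started at `0` with steps `z`. -/
def walkPos {d : ℕ} {R : Finset (Fin d → ℤ)} (z : ℕ → R) (n : ℕ) : stepGroup R :=
  ∑ i ∈ Finset.range n, ⟨(z i : Fin d → ℤ), AddSubgroup.subset_closure (z i).2⟩

/-- The energy of the first `n` steps, the sum over `k < n` of the potential `g` evaluated at
the environment shifted to the walk's position at time `k` and at the next `ℓ` steps.
The shift of `ω` by `x` is written `x +ᵥ ω`. -/
def pathEnergy {d : ℕ} {R : Finset (Fin d → ℤ)} {Ω : Type*} [AddAction (stepGroup R) Ω]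
    {ℓ : ℕ} (g : Ω → (Fin ℓ → R) → ℝ) (ω : Ω) (n : ℕ) (z : ℕ → R) : ℝ :=
  ∑ k ∈ Finset.range n, g (walkPos z k +ᵥ ω) (fun j : Fin ℓ => z (k + j))

/-- The quenched point-to-point partition function: the expectation, over the walk, of the
exponential of the energy of `n` steps, restricted to the event that the walk is at `x` at
time `n`. -/
def partitionFn {d : ℕ} {R : Finset (Fin d → ℤ)} [Nonempty R] {Ω : Type*}
    [AddAction (stepGroup R) Ω] {ℓ : ℕ} (g : Ω → (Fin ℓ → R) → ℝ) (ω : Ω) (n : ℕ)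
    (x : Fin d → ℤ) : ℝ :=
  ∫ z in {z : ℕ → R | (walkPos z n : Fin d → ℤ) = x}, Real.exp (pathEnergy g ω n z) ∂(stepLaw R)

/-- `y` is a path with steps in `R` that, for some `k ≥ 1`, is at `m k ξ` at each time `m k`
(in particular it starts at `0`). -/
def IsRationalPath {d : ℕ} (R : Finset (Fin d → ℤ)) (ξ : Fin d → ℚ) (y : ℕ → Fin d → ℤ) :
    Prop :=
  (∀ n : ℕ, y (n + 1) - y n ∈ R) ∧
    ∃ k : ℕ, 1 ≤ k ∧ ∀ (m : ℕ) (i : Fin d), (y (m * k) i : ℚ) = (m : ℚ) * (k : ℚ) * ξ i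

end

/-!
The logarithm of the partition function is superadditive up to a boundary cost. Let the path visit
`m • v` at each time `m * k`. A walk to `m • v`, continued from there by an independent
walk with displacement `n • v`, is a walk to `(m + n) • v` (`map_concatSteps`). Since the
potential looks `ℓ` steps ahead, gluing the two changes the energy only in the last `ℓ` steps before the junction, by at most
`2 * ℓ` times a finite sum of `|g|` over environments near the junction
(`abs_pathEnergy_sub_le`, `partitionFn_mul_le`). Subtracting this cost at the endpoint makes the
logarithm an exactly superadditive sequence along the orbits of the shift by `v`, and its first
term is integrable because `|log partitionFn|` is bounded by a finite sum of translates of `|g|`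
(`abs_log_partitionFn_le`).

Such a sequence converges after division by `m`, by the subadditive ergodic theorem
`SuperadditiveAlong.ae_exists_tendsto`. The integrals of its terms may grow faster than linearly,
which is why the limit may be `⊤`. After adding the ergodic sums of `|a 1|` the sequence is nonnegative,
and then no integrability is needed: where `b n - c * n` is unbounded above, which up to null sets
is an invariant property, a greedy covering of the orbit (`SuperadditiveAlong.covering_bound`)
gives `b n ≥ c * (n - N - S n)`, where `S n` counts the visits up to time `n` to a set of small
measure. Applied to ergodic sums, the same covering yields a weak-type inequality
(`mul_measure_growthSet_birkhoffSum_le`), which bounds the frequency of these visits. Hence growth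
at rate `c` along some times forces growth at every smaller rate along all times.

Times between multiples of `k` are handled by monotonicity up to a cost that is a fixed integrable
function evaluated along the orbit, hence `o(m)` (`exists_tendsto_of_tendsto_multiples`). There are
only countably many pairs `(k, v)`, so the exceptional null set serves all directions and paths.
Two paths with the same direction meet at all multiples of a common period, so their limits agree.
-/

/-! ### The subadditive ergodic theorem -/

/-- A sequence of functions `b 1, b 2, …` that is superadditive along the orbits of `τ`. The
value `b 0` plays no role. -/
def SuperadditiveAlong {Ω : Type*} (τ : Ω → Ω) (b : ℕ → Ω → ℝ) : Prop :=
  ∀ m n : ℕ, 1 ≤ m → 1 ≤ n → ∀ ω, b m ω + b n (τ^[m] ω) ≤ b (m + n) ω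

/-- The set where `b n - c * n` is unbounded above. It lies between
`{limsup b n / n > c}` and `{limsup b n / n ≥ c}`, and it is invariant up to null sets. -/
def growthSet {Ω : Type*} (b : ℕ → Ω → ℝ) (c : ℝ) : Set Ω :=
  {ω | ∀ K : ℕ, ∃ n : ℕ, 1 ≤ n ∧ c * n + K < b n ω}

/-- Addition of a convergent real sequence is harmless for limits in `EReal`. -/
theorem tendsto_coe_add_of_tendsto {ι : Type*} {l : Filter ι} {x y : ι → ℝ} {L : EReal} {s : ℝ}
    (hx : Tendsto (fun i => (x i : EReal)) l (𝓝 L)) (hy : Tendsto y l (𝓝 s)) :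
    Tendsto (fun i => ((x i + y i : ℝ) : EReal)) l (𝓝 (L + s)) := by
  have hadd : Tendsto (fun p : EReal × EReal => p.1 + p.2) (𝓝 (L, (s : EReal)))
      (𝓝 (L + (s : EReal))) :=
    EReal.continuousAt_add (Or.inr (EReal.coe_ne_bot _)) (Or.inr (EReal.coe_ne_top _))
  exact hadd.comp (hx.prodMk_nhds (EReal.tendsto_coe.2 hy))

section Ergodic

variable {Ω : Type*} {τ : Ω → Ω} {b : ℕ → Ω → ℝ}

theorem superadditiveAlong_birkhoffSum (τ : Ω → Ω) (f : Ω → ℝ) :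
    SuperadditiveAlong τ (birkhoffSum τ f) :=
  fun m n _ _ ω => (birkhoffSum_add τ f m n ω).ge

theorem birkhoffSum_nonneg {f : Ω → ℝ} (hf : ∀ ω, 0 ≤ f ω) (n : ℕ) (ω : Ω) :
    0 ≤ birkhoffSum τ f n ω :=
  Finset.sum_nonneg fun _ _ => hf _

/-- The covering argument: cut the orbit segment of length `L` greedily into blocks of length at
most `N` on which `b` grows at rate at least `c`, single points of `E`, and a remainder of
length at most `N`. -/
theorem SuperadditiveAlong.covering_bound (hb : SuperadditiveAlong τ b)
    (hpos : ∀ n, 1 ≤ n → ∀ ω, 0 ≤ b n ω) {c : ℝ} (hc : 0 ≤ c) {N : ℕ} {E : Set Ω} (L : ℕ) :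
    ∀ ω, 1 ≤ L →
      (∀ i, τ^[i] ω ∈ E ∨ ∃ j : ℕ, 1 ≤ j ∧ j ≤ N ∧ c * j ≤ b j (τ^[i] ω)) →
      c * (L - N - birkhoffSum τ (E.indicator 1) L ω) ≤ b L ω := by
  have hS : ∀ n ω, 0 ≤ birkhoffSum τ (E.indicator (1 : Ω → ℝ)) n ω := fun n ω =>
    birkhoffSum_nonneg (fun ω => Set.indicator_nonneg (fun _ _ => zero_le_one) ω) n ω
  induction L using Nat.strong_induction_on with
  | _ L ih =>
    intro ω hL h
    have hsplit : ∀ j, j ≤ L → birkhoffSum τ (E.indicator (1 : Ω → ℝ)) L ω =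
        birkhoffSum τ (E.indicator 1) j ω
          + birkhoffSum τ (E.indicator 1) (L - j) (τ^[j] ω) := by
      intro j hj
      rw [← birkhoffSum_add, Nat.add_sub_cancel' hj]
    have hshift : ∀ j i, τ^[i] (τ^[j] ω) ∈ E ∨
        ∃ j' : ℕ, 1 ≤ j' ∧ j' ≤ N ∧ c * j' ≤ b j' (τ^[i] (τ^[j] ω)) := by
      intro j i
      rw [← Function.iterate_add_apply]
      exact h (i + j)
    rcases le_or_gt L N with hLN | hLN
    · have h1 : (L : ℝ) ≤ N := by exact_mod_cast hLN
      have h2 := hS L ω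
      exact (mul_nonpos_of_nonneg_of_nonpos hc (by linarith)).trans (hpos L hL ω)
    · have key : ∀ j : ℕ, 1 ≤ j → j < L →
          c * (j - birkhoffSum τ (E.indicator 1) j ω) ≤ b j ω →
          c * (L - N - birkhoffSum τ (E.indicator 1) L ω) ≤ b L ω := by
        intro j hj hjL hbj
        have h1 := ih (L - j) (by omega) (τ^[j] ω) (by omega) (hshift j)
        have h2 := hb j (L - j) hj (by omega) ω
        rw [Nat.add_sub_cancel' hjL.le] at h2
        rw [hsplit j hjL.le]
        rw [Nat.cast_sub hjL.le] at h1
        linarith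
      rcases h 0 with h0 | ⟨j, hj1, hjN, hj⟩
      · have h1 : birkhoffSum τ (E.indicator (1 : Ω → ℝ)) 1 ω = 1 := by
          have h0' : ω ∈ E := h0
          simp [h0']
        rcases Nat.eq_or_lt_of_le hL with rfl | hL1
        · rw [h1]
          have : (0 : ℝ) ≤ N := Nat.cast_nonneg N
          refine (mul_nonpos_of_nonneg_of_nonpos hc ?_).trans (hpos 1 le_rfl ω)
          push_cast
          linarith
        · refine key 1 le_rfl hL1 ?_
          rw [h1]
          simpa using hpos 1 le_rfl ω
      · refine key j hj1 (by omega) (le_trans ?_ hj)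
        have := hS j ω
        exact mul_le_mul_of_nonneg_left (by linarith) hc

theorem preimage_growthSet_subset (hb : SuperadditiveAlong τ b)
    (hpos : ∀ n, 1 ≤ n → ∀ ω, 0 ≤ b n ω) {c : ℝ} (i : ℕ) :
    τ^[i] ⁻¹' growthSet b c ⊆ growthSet b c := by
  rcases Nat.eq_zero_or_pos i with rfl | hi
  · simp
  intro ω hω K
  obtain ⟨K', hK'⟩ := exists_nat_ge (c * i)
  obtain ⟨n, hn, h⟩ := hω (K' + K)
  refine ⟨i + n, by omega, ?_⟩
  have h1 := hb i n hi hn ω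
  have h2 := hpos i hi ω
  push_cast at h ⊢
  linarith

theorem growthSet_subset_of_frequently {c c' : ℝ} (hcc : c < c') {ω : Ω}
    (h : ∃ᶠ n : ℕ in atTop, c' * n ≤ b n ω) : ω ∈ growthSet b c := by
  intro K
  have h1 : ∀ᶠ n : ℕ in atTop, (K : ℝ) < (c' - c) * n :=
    (tendsto_natCast_atTop_atTop.const_mul_atTop (sub_pos.2 hcc)).eventually_gt_atTop _
  obtain ⟨n, h2, h3, h4⟩ := (h.and_eventually (h1.and (eventually_ge_atTop 1))).exists
  exact ⟨n, h4, by linarith⟩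

variable [MeasurableSpace Ω] {μ : Measure Ω}

theorem measurableSet_growthSet (hm : ∀ n, Measurable (b n)) (c : ℝ) :
    MeasurableSet (growthSet b c) := by
  have : growthSet b c = ⋂ K : ℕ, ⋃ n : ℕ, {ω | 1 ≤ n ∧ c * n + K < b n ω} := by
    ext ω
    simp [growthSet]
  rw [this]
  exact MeasurableSet.iInter fun K => MeasurableSet.iUnion fun n =>
    (MeasurableSet.const _).inter (measurableSet_lt measurable_const (hm n))

theorem ae_iterate_mem_growthSet [IsFiniteMeasure μ] (hτ : MeasurePreserving τ μ μ)
    (hm : ∀ n, Measurable (b n)) (hb : SuperadditiveAlong τ b)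
    (hpos : ∀ n, 1 ≤ n → ∀ ω, 0 ≤ b n ω) (c : ℝ) :
    ∀ᵐ ω ∂μ, ω ∈ growthSet b c → ∀ i, τ^[i] ω ∈ growthSet b c := by
  have h : ∀ i, τ^[i] ⁻¹' growthSet b c =ᵐ[μ] growthSet b c := fun i => by
    have hV := measurableSet_growthSet hm c
    refine ae_eq_of_subset_of_measure_ge (preimage_growthSet_subset hb hpos i) ?_
      ((hτ.iterate i).measurable hV).nullMeasurableSet (measure_ne_top _ _)
    exact ((hτ.iterate i).measure_preimage hV.nullMeasurableSet).ge
  filter_upwards [ae_all_iff.2 fun i => (h i).mem_iff] with ω hω hωV i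
  exact (hω i).2 hωV

/-- On the growth set, linear growth is reached within a bounded time outside a set of small
measure, so the covering argument gives a lower bound valid for every length. -/
theorem exists_covering_bound_on_growthSet [IsFiniteMeasure μ] (hτ : MeasurePreserving τ μ μ)
    (hm : ∀ n, Measurable (b n)) (hb : SuperadditiveAlong τ b)
    (hpos : ∀ n, 1 ≤ n → ∀ ω, 0 ≤ b n ω) {c : ℝ} (hc : 0 ≤ c) {η : ℝ} (hη : 0 < η) :
    ∃ (N : ℕ) (E : Set Ω), MeasurableSet E ∧ μ.real E < η ∧
      ∀ᵐ ω ∂μ, ω ∈ growthSet b c → ∀ L : ℕ, 1 ≤ L →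
        c * (L - N - birkhoffSum τ (E.indicator 1) L ω) ≤ b L ω := by
  -- Points of the growth set at which rate `c` is not reached within time `N`.
  set E : ℕ → Set Ω := fun N =>
    growthSet b c ∩ ⋂ j : ℕ, {ω | 1 ≤ j ∧ j ≤ N → b j ω < c * j} with hE
  have hEm : ∀ N, MeasurableSet (E N) := fun N =>
    (measurableSet_growthSet hm c).inter <| MeasurableSet.iInter fun j =>
      (MeasurableSet.const _).imp (measurableSet_lt (hm j) measurable_const)
  have hanti : Antitone E := by
    intro N N' hN ω hω
    refine ⟨hω.1, Set.mem_iInter.2 fun j hj => Set.mem_iInter.1 hω.2 j ⟨hj.1, hj.2.trans hN⟩⟩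
  have hempty : ⋂ N, E N = ∅ := by
    refine Set.eq_empty_iff_forall_notMem.2 fun ω hω => ?_
    rw [Set.mem_iInter] at hω
    obtain ⟨n, hn, h⟩ := (hω 0).1 0
    have := Set.mem_iInter.1 (hω n).2 n ⟨hn, le_rfl⟩
    simp only [Nat.cast_zero, add_zero] at h
    exact lt_asymm h this
  have hlim : Tendsto (fun N => μ.real (E N)) atTop (𝓝 0) := by
    have h := tendsto_measure_iInter_atTop (μ := μ) (fun N => (hEm N).nullMeasurableSet) hanti
      ⟨0, measure_ne_top _ _⟩
    rw [hempty, measure_empty] at h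
    exact (ENNReal.tendsto_toReal ENNReal.zero_ne_top).comp h
  obtain ⟨N, hN⟩ := (hlim.eventually_lt_const hη).exists
  refine ⟨N, E N, hEm N, hN, ?_⟩
  filter_upwards [ae_iterate_mem_growthSet hτ hm hb hpos c] with ω hω hωV L hL
  refine hb.covering_bound hpos hc L ω hL fun i => ?_
  by_contra hcon
  push Not at hcon
  refine hcon.1 ⟨hω hωV i, Set.mem_iInter.2 fun j hj => ?_⟩
  exact hcon.2 j hj.1 hj.2

theorem integrable_birkhoffSum (hτ : MeasurePreserving τ μ μ) {f : Ω → ℝ}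
    (hf : Integrable f μ) (n : ℕ) : Integrable (birkhoffSum τ f n) μ := by
  have : birkhoffSum τ f n = fun ω => ∑ i ∈ Finset.range n, f (τ^[i] ω) := rfl
  rw [this]
  exact integrable_finsetSum _ fun i _ => (hτ.iterate i).integrable_comp_of_integrable hf

theorem measurable_birkhoffSum (hτ : Measurable τ) {f : Ω → ℝ}
    (hf : Measurable f) (n : ℕ) : Measurable (birkhoffSum τ f n) := by
  have : birkhoffSum τ f n = fun ω => ∑ i ∈ Finset.range n, f (τ^[i] ω) := rfl
  rw [this]
  exact Finset.measurable_fun_sum _ fun i _ => hf.comp (hτ.iterate i)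

theorem integral_birkhoffSum (hτ : MeasurePreserving τ μ μ) {f : Ω → ℝ}
    (hf : Integrable f μ) (n : ℕ) : ∫ ω, birkhoffSum τ f n ω ∂μ = n * ∫ ω, f ω ∂μ := by
  simp only [birkhoffSum]
  rw [integral_finsetSum (f := fun i ω => f (τ^[i] ω)) _
    fun i _ => (hτ.iterate i).integrable_comp_of_integrable hf]
  have : ∀ i, ∫ ω, f (τ^[i] ω) ∂μ = ∫ ω, f ω ∂μ := fun i => by
    conv_rhs => rw [← (hτ.iterate i).map_eq]
    rw [integral_map (hτ.iterate i).measurable.aemeasurable]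
    rw [(hτ.iterate i).map_eq]
    exact hf.aestronglyMeasurable
  simp [this]

/-- A weak-type inequality for the growth rate of the ergodic sums of a nonnegative function. -/
theorem mul_measure_growthSet_birkhoffSum_le [IsFiniteMeasure μ] (hτ : MeasurePreserving τ μ μ)
    {f : Ω → ℝ} (hfm : Measurable f) (hf : Integrable f μ) (hf0 : ∀ ω, 0 ≤ f ω)
    {t : ℝ} (ht : 0 ≤ t) :
    t * μ.real (growthSet (birkhoffSum τ f) t) ≤ ∫ ω, f ω ∂μ := by
  set V := growthSet (birkhoffSum τ f) t with hVdef
  have hSm := measurable_birkhoffSum (f := f) hτ.measurable hfm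
  have hV : MeasurableSet V := measurableSet_growthSet hSm t
  refine le_of_forall_pos_le_add fun ε hε => ?_
  have hη : 0 < ε / (t + 1) := div_pos hε (by linarith)
  obtain ⟨N, E, hE, hEη, h⟩ := exists_covering_bound_on_growthSet hτ hSm
    (superadditiveAlong_birkhoffSum τ f) (fun n _ ω => birkhoffSum_nonneg hf0 n ω) ht hη
  have hEi : Integrable (E.indicator (1 : Ω → ℝ)) μ := (integrable_const (1 : ℝ)).indicator hE
  have key : ∀ L : ℕ, 1 ≤ L →
      t * ((L - N) * μ.real V - L * μ.real E) ≤ L * ∫ ω, f ω ∂μ := by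
    intro L hL
    have hEL := integrable_birkhoffSum hτ hEi L
    have hE0 : ∀ ω, 0 ≤ birkhoffSum τ (E.indicator (1 : Ω → ℝ)) L ω := fun ω =>
      birkhoffSum_nonneg (fun ω => Set.indicator_nonneg (fun _ _ => zero_le_one) ω) L ω
    calc t * ((L - N) * μ.real V - L * μ.real E)
        ≤ t * ((L - N) * μ.real V - ∫ ω in V, birkhoffSum τ (E.indicator 1) L ω ∂μ) := by
          have h1 : ∫ ω in V, birkhoffSum τ (E.indicator (1 : Ω → ℝ)) L ω ∂μ ≤ L * μ.real E := by
            refine (setIntegral_le_integral hEL (ae_of_all _ hE0)).trans ?_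
            rw [integral_birkhoffSum hτ hEi, integral_indicator_one hE]
          exact mul_le_mul_of_nonneg_left (by linarith) ht
      _ = ∫ ω in V, t * (L - N - birkhoffSum τ (E.indicator 1) L ω) ∂μ := by
          rw [integral_const_mul, integral_sub (integrable_const _) hEL.integrableOn]
          simp [mul_comm]
      _ ≤ ∫ ω in V, birkhoffSum τ f L ω ∂μ := by
          refine setIntegral_mono_on_ae ?_ (integrable_birkhoffSum hτ hf L).integrableOn hV ?_
          · exact (((integrable_const _).sub hEL).const_mul t).integrableOn
          · filter_upwards [h] with ω hω hωV
            exact hω hωV L hL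
      _ ≤ ∫ ω, birkhoffSum τ f L ω ∂μ :=
          setIntegral_le_integral (integrable_birkhoffSum hτ hf L)
            (ae_of_all _ fun ω => birkhoffSum_nonneg hf0 L ω)
      _ = L * ∫ ω, f ω ∂μ := integral_birkhoffSum hτ hf L
  have hlim : Tendsto (fun L : ℕ => t * ((1 - N * (L : ℝ)⁻¹) * μ.real V - μ.real E)) atTop
      (𝓝 (t * ((1 - N * 0) * μ.real V - μ.real E))) :=
    ((((tendsto_inv_atTop_nhds_zero_nat (𝕜 := ℝ)).const_mul (N : ℝ)).const_sub 1).mul_const _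
      |>.sub_const _).const_mul t
  have h2 : t * ((1 - N * 0) * μ.real V - μ.real E) ≤ ∫ ω, f ω ∂μ := by
    refine le_of_tendsto hlim ?_
    filter_upwards [eventually_ge_atTop 1] with L hL
    have hL' : (0 : ℝ) < L := by exact_mod_cast hL
    have h3 := key L hL
    refine le_of_mul_le_mul_left ?_ hL'
    calc (L : ℝ) * (t * ((1 - N * (L : ℝ)⁻¹) * μ.real V - μ.real E))
        = t * ((L - N) * μ.real V - L * μ.real E) := by field_simp
      _ ≤ _ := h3
  have h4 : t * μ.real E ≤ ε := by
    calc t * μ.real E ≤ (t + 1) * (ε / (t + 1)) :=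
          mul_le_mul (by linarith) hEη.le measureReal_nonneg (by linarith)
      _ = ε := by field_simp
  linarith

/-- Where a nonnegative superadditive sequence grows at rate `c` along some times, it grows
at every smaller rate along all times. -/
theorem ae_eventually_le_of_mem_growthSet [IsFiniteMeasure μ] (hτ : MeasurePreserving τ μ μ)
    (hm : ∀ n, Measurable (b n)) (hb : SuperadditiveAlong τ b)
    (hpos : ∀ n, 1 ≤ n → ∀ ω, 0 ≤ b n ω) {c c' : ℝ} (hc : 0 < c) (hcc : c' < c) :
    ∀ᵐ ω ∂μ, ω ∈ growthSet b c → ∀ᶠ n : ℕ in atTop, c' * n ≤ b n ω := by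
  -- With visits to the exceptional set of frequency at most `t`, the covering bound has rate
  -- `c * (1 - t) = (c + c') / 2 > c'`.
  set t : ℝ := (c - c') / (2 * c) with ht_def
  have ht : 0 < t := div_pos (by linarith) (by linarith)
  have hct : c * t = (c - c') / 2 := by
    rw [ht_def]
    field_simp
  choose N E hE hEη h using fun k : ℕ =>
    exists_covering_bound_on_growthSet hτ hm hb hpos hc.le (Nat.one_div_pos_of_nat (n := k))
  have hEm : ∀ k, Measurable ((E k).indicator (1 : Ω → ℝ)) := fun k =>
    measurable_one.indicator (hE k)
  set W : ℕ → Set Ω := fun k => growthSet (birkhoffSum τ ((E k).indicator 1)) t with hW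
  have hW0 : μ.real (⋂ k, W k) = 0 := by
    have hle : ∀ k : ℕ, μ.real (⋂ k, W k) ≤ t⁻¹ * (1 / ((k : ℝ) + 1)) := by
      intro k
      have h1 := mul_measure_growthSet_birkhoffSum_le hτ (hEm k)
        ((integrable_const (1 : ℝ)).indicator (hE k))
        (fun ω => Set.indicator_nonneg (fun _ _ => zero_le_one) ω) ht.le
      rw [integral_indicator_one (hE k)] at h1
      have h2 : μ.real (⋂ k, W k) ≤ μ.real (W k) := measureReal_mono (Set.iInter_subset _ k)
      have h3 : μ.real (W k) ≤ t⁻¹ * μ.real (E k) := by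
        rw [← mul_le_mul_iff_right₀ ht, mul_inv_cancel_left₀ ht.ne']
        exact h1
      exact h2.trans (h3.trans (mul_le_mul_of_nonneg_left (hEη k).le (inv_nonneg.2 ht.le)))
    refine le_antisymm (ge_of_tendsto' (x := atTop) ?_ hle) measureReal_nonneg
    simpa using (tendsto_one_div_add_atTop_nhds_zero_nat (𝕜 := ℝ)).const_mul t⁻¹
  have hW1 : ∀ᵐ ω ∂μ, ω ∉ ⋂ k, W k :=
    measure_eq_zero_iff_ae_notMem.1 ((measureReal_eq_zero_iff (measure_ne_top _ _)).1 hW0)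
  filter_upwards [hW1, ae_all_iff.2 h] with ω hω1 hω2 hωV
  obtain ⟨k, hk⟩ : ∃ k, ω ∉ W k := by simpa using hω1
  obtain ⟨K, hK⟩ : ∃ K : ℕ, ∀ n : ℕ, 1 ≤ n →
      birkhoffSum τ ((E k).indicator 1) n ω ≤ t * n + K := by
    simpa [hW, growthSet] using hk
  have h1 : ∀ᶠ n : ℕ in atTop, c * (N k + K) ≤ (c - c') / 2 * n :=
    (tendsto_natCast_atTop_atTop.const_mul_atTop (by linarith)).eventually_ge_atTop _
  filter_upwards [h1, eventually_ge_atTop 1] with n hn hn1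
  refine le_trans ?_ (hω2 k hωV n hn1)
  have h3 := mul_le_mul_of_nonneg_left (hK n hn1) hc.le
  have h4 : c * (t * n) = (c - c') / 2 * n := by rw [← hct]; ring
  nlinarith

theorem ae_exists_tendsto_of_nonneg [IsFiniteMeasure μ] (hτ : MeasurePreserving τ μ μ)
    (hm : ∀ n, Measurable (b n)) (hb : SuperadditiveAlong τ b)
    (hpos : ∀ n, 1 ≤ n → ∀ ω, 0 ≤ b n ω) :
    ∀ᵐ ω ∂μ, ∃ L : EReal,
      Tendsto (fun n : ℕ => (((n : ℝ)⁻¹ * b n ω : ℝ) : EReal)) atTop (𝓝 L) := by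
  have h : ∀ᵐ ω ∂μ, ∀ p q : ℚ, 0 < q → p < q → ω ∈ growthSet b q →
      ∀ᶠ n : ℕ in atTop, (p : ℝ) * n ≤ b n ω := by
    refine ae_all_iff.2 fun p => ae_all_iff.2 fun q => ?_
    by_cases hq : 0 < q
    · by_cases hpq : p < q
      · filter_upwards [ae_eventually_le_of_mem_growthSet hτ hm hb hpos
          (c := q) (c' := p) (by exact_mod_cast hq) (by exact_mod_cast hpq)] with ω hω _ _
        exact hω
      · exact ae_of_all _ fun ω _ h => absurd h hpq
    · exact ae_of_all _ fun ω h => absurd h hq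
  filter_upwards [h] with ω hω
  refine tendsto_of_no_upcrossings dense_univ fun p _ q _ hpq => ?_
  rintro ⟨hp, hq⟩
  obtain ⟨p', hp1, hp2⟩ := EReal.lt_iff_exists_rat_btwn.1 hpq
  obtain ⟨q', hq1, hq2⟩ := EReal.lt_iff_exists_rat_btwn.1 hp2
  obtain ⟨q'', hr1, hr2⟩ := EReal.lt_iff_exists_rat_btwn.1 hq2
  have e1 : p' < q' := by exact_mod_cast hq1
  have e2 : q' < q'' := by exact_mod_cast hr1
  -- Since `b n ≥ 0`, values of `b n / n` below `p'` force `p' > 0`.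
  have hp0 : 0 < p' := by
    obtain ⟨n, hn, hn1⟩ := (hp.and_eventually (eventually_ge_atTop 1)).exists
    have h1 : ((((n : ℝ)⁻¹ * b n ω : ℝ)) : EReal) < ((p' : ℝ) : EReal) := hn.trans hp1
    have h2 : (n : ℝ)⁻¹ * b n ω < (p' : ℝ) := EReal.coe_lt_coe_iff.1 h1
    have h3 : 0 ≤ (n : ℝ)⁻¹ * b n ω := mul_nonneg (by positivity) (hpos n hn1 ω)
    exact_mod_cast h3.trans_lt h2
  have hV : ω ∈ growthSet b (q' : ℝ) := by
    refine growthSet_subset_of_frequently (c' := q'') (by exact_mod_cast e2) ?_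
    refine (hq.and_eventually (eventually_ge_atTop 1)).mono ?_
    rintro n ⟨hn, hn1⟩
    have hn0 : (0 : ℝ) < n := by exact_mod_cast hn1
    have h1 : (((q'' : ℝ)) : EReal) < ((((n : ℝ)⁻¹ * b n ω : ℝ)) : EReal) := hr2.trans hn
    have h2 : (q'' : ℝ) < (n : ℝ)⁻¹ * b n ω := EReal.coe_lt_coe_iff.1 h1
    rw [inv_mul_eq_div, lt_div_iff₀ hn0] at h2
    exact h2.le
  obtain ⟨n, hn, hn2, hn1⟩ := (hp.and_eventually
    ((hω p' q' (hp0.trans e1) e1 hV).and (eventually_ge_atTop 1))).exists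
  have hn0 : (0 : ℝ) < n := by exact_mod_cast hn1
  have h1 : ((((n : ℝ)⁻¹ * b n ω : ℝ)) : EReal) < ((p' : ℝ) : EReal) := hn.trans hp1
  have h2 : (n : ℝ)⁻¹ * b n ω < (p' : ℝ) := EReal.coe_lt_coe_iff.1 h1
  rw [inv_mul_eq_div, div_lt_iff₀ hn0] at h2
  linarith

/-- The pointwise ergodic theorem for a nonnegative integrable function; the value of the limit
is not needed. -/
theorem ae_exists_tendsto_birkhoffSum [IsFiniteMeasure μ] (hτ : MeasurePreserving τ μ μ)
    {f : Ω → ℝ} (hfm : Measurable f) (hf : Integrable f μ) (hf0 : ∀ ω, 0 ≤ f ω) :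
    ∀ᵐ ω ∂μ, ∃ s : ℝ,
      Tendsto (fun n : ℕ => (n : ℝ)⁻¹ * birkhoffSum τ f n ω) atTop (𝓝 s) := by
  have hSm := measurable_birkhoffSum (f := f) hτ.measurable hfm
  have hS0 : ∀ n ω, 0 ≤ birkhoffSum τ f n ω := fun n ω => birkhoffSum_nonneg hf0 n ω
  have h0 : μ.real (⋂ k : ℕ, growthSet (birkhoffSum τ f) (k + 1)) = 0 := by
    have hle : ∀ k : ℕ, μ.real (⋂ k : ℕ, growthSet (birkhoffSum τ f) (k + 1)) ≤
        (∫ ω, f ω ∂μ) * (1 / ((k : ℝ) + 1)) := by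
      intro k
      refine (measureReal_mono (Set.iInter_subset _ k)).trans ?_
      have hk : (0 : ℝ) < k + 1 := by positivity
      rw [mul_one_div, le_div_iff₀ hk, mul_comm]
      exact mul_measure_growthSet_birkhoffSum_le hτ hfm hf hf0 hk.le
    refine le_antisymm (ge_of_tendsto' (x := atTop) ?_ hle) measureReal_nonneg
    simpa using (tendsto_one_div_add_atTop_nhds_zero_nat (𝕜 := ℝ)).const_mul (∫ ω, f ω ∂μ)
  have h1 : ∀ᵐ ω ∂μ, ω ∉ ⋂ k : ℕ, growthSet (birkhoffSum τ f) (k + 1) :=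
    measure_eq_zero_iff_ae_notMem.1 ((measureReal_eq_zero_iff (measure_ne_top _ _)).1 h0)
  filter_upwards [h1, ae_exists_tendsto_of_nonneg hτ hSm (superadditiveAlong_birkhoffSum τ f)
    fun n _ ω => hS0 n ω] with ω hω1 ⟨L, hL⟩
  obtain ⟨k, hk⟩ : ∃ k : ℕ, ω ∉ growthSet (birkhoffSum τ f) (k + 1) := by simpa using hω1
  have hLtop : L ≠ ⊤ := by
    rintro rfl
    refine hk (growthSet_subset_of_frequently (c' := k + 2) (by linarith) ?_)
    refine Eventually.frequently ?_
    filter_upwards [(EReal.tendsto_nhds_top_iff_real.1 hL) (k + 2), eventually_ge_atTop 1]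
      with n hn hn1
    have hn0 : (0 : ℝ) < n := by exact_mod_cast hn1
    have h2 := EReal.coe_lt_coe_iff.1 hn
    rw [inv_mul_eq_div, lt_div_iff₀ hn0] at h2
    exact h2.le
  have hLbot : L ≠ ⊥ := by
    have : (0 : EReal) ≤ L := ge_of_tendsto' hL fun n => by
      exact_mod_cast mul_nonneg (by positivity) (hS0 n ω)
    exact (EReal.bot_lt_zero.trans_le this).ne'
  lift L to ℝ using ⟨hLtop, hLbot⟩
  exact ⟨L, EReal.tendsto_coe.1 hL⟩

theorem ae_tendsto_inv_mul_iterate [IsFiniteMeasure μ] (hτ : MeasurePreserving τ μ μ)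
    {f : Ω → ℝ} (hfm : Measurable f) (hf : Integrable f μ) (hf0 : ∀ ω, 0 ≤ f ω) :
    ∀ᵐ ω ∂μ, Tendsto (fun n : ℕ => (n : ℝ)⁻¹ * f (τ^[n] ω)) atTop (𝓝 0) := by
  filter_upwards [ae_exists_tendsto_birkhoffSum hτ hfm hf hf0] with ω ⟨s, hs⟩
  have h1 : Tendsto (fun n : ℕ => ((n + 1 : ℕ) : ℝ)⁻¹ * birkhoffSum τ f (n + 1) ω) atTop (𝓝 s) :=
    hs.comp (tendsto_add_atTop_nat 1)
  have h2 : Tendsto (fun n : ℕ => 1 + (n : ℝ)⁻¹) atTop (𝓝 (1 + 0)) :=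
    (tendsto_inv_atTop_nhds_zero_nat (𝕜 := ℝ)).const_add 1
  have h3 := (h2.mul h1).sub hs
  simp only [add_zero, one_mul, sub_self] at h3
  refine h3.congr' ?_
  filter_upwards [eventually_ge_atTop 1] with n hn
  have hn0 : (0 : ℝ) < n := by exact_mod_cast hn
  rw [birkhoffSum_succ]
  push_cast
  field_simp
  ring

/-- The subadditive ergodic theorem, in superadditive form: no bound on the integrals of the
`a n` is assumed, so the limit may be `⊤`. -/
theorem SuperadditiveAlong.ae_exists_tendsto [IsFiniteMeasure μ] {a : ℕ → Ω → ℝ}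
    (ha : SuperadditiveAlong τ a) (hτ : MeasurePreserving τ μ μ)
    (hm : ∀ n, Measurable (a n)) (hi : Integrable (a 1) μ) :
    ∀ᵐ ω ∂μ, ∃ L : EReal, L ≠ ⊥ ∧
      Tendsto (fun n : ℕ => (((n : ℝ)⁻¹ * a n ω : ℝ) : EReal)) atTop (𝓝 L) := by
  set h : Ω → ℝ := fun ω => |a 1 ω| with hh
  have hhm : Measurable h := (hm 1).abs
  have hh0 : ∀ ω, 0 ≤ h ω := fun ω => abs_nonneg _
  -- Adding the ergodic sums of `|a 1|` makes the sequence nonnegative.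
  set b : ℕ → Ω → ℝ := fun n ω => a n ω + birkhoffSum τ h n ω with hb_def
  have hb : SuperadditiveAlong τ b := fun m n hm hn ω => by
    have h1 := ha m n hm hn ω
    have h2 := birkhoffSum_add τ h m n ω
    simp only [hb_def]
    linarith
  have hpos : ∀ n, 1 ≤ n → ∀ ω, 0 ≤ b n ω := by
    intro n hn
    induction n, hn using Nat.le_induction with
    | base =>
      intro ω
      simp only [hb_def, birkhoffSum_one, hh]
      linarith [neg_abs_le (a 1 ω)]
    | succ n hn ih =>
      intro ω
      refine le_trans ?_ (hb n 1 hn le_rfl ω)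
      have : 0 ≤ b 1 (τ^[n] ω) := by
        simp only [hb_def, birkhoffSum_one, hh]
        linarith [neg_abs_le (a 1 (τ^[n] ω))]
      linarith [ih ω]
  have hbm : ∀ n, Measurable (b n) := fun n =>
    (hm n).add (measurable_birkhoffSum hτ.measurable hhm n)
  filter_upwards [ae_exists_tendsto_of_nonneg hτ hbm hb hpos,
    ae_exists_tendsto_birkhoffSum hτ hhm hi.abs hh0] with ω ⟨u, hu⟩ ⟨s, hs⟩
  have hu0 : u ≠ ⊥ := by
    have : (0 : EReal) ≤ u := by
      refine ge_of_tendsto hu ?_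
      filter_upwards [eventually_ge_atTop 1] with n hn
      exact_mod_cast mul_nonneg (by positivity) (hpos n hn ω)
    exact (EReal.bot_lt_zero.trans_le this).ne'
  refine ⟨u + ((-s : ℝ) : EReal), ?_, ?_⟩
  · simp [EReal.add_eq_bot_iff, hu0]
  · refine (tendsto_coe_add_of_tendsto hu hs.neg).congr fun n => ?_
    simp only [hb_def]
    congr 1
    ring

end Ergodic

/-! ### Positions and steps of the walk -/

section Walk

variable {d : ℕ} {R : Finset (Fin d → ℤ)}

theorem walkPos_zero (z : ℕ → R) : walkPos z 0 = 0 := rfl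

theorem walkPos_congr {z z' : ℕ → R} {n : ℕ} (h : ∀ i < n, z i = z' i) :
    walkPos z n = walkPos z' n := by
  unfold walkPos
  exact Finset.sum_congr rfl fun i hi =>
    Subtype.ext (congrArg (fun r : R => (r : Fin d → ℤ)) (h i (Finset.mem_range.1 hi)))

theorem walkPos_add (z : ℕ → R) (m n : ℕ) :
    walkPos z (m + n) = walkPos z m + walkPos (fun i => z (m + i)) n :=
  Finset.sum_range_add _ m n

theorem finite_range_walkPos (n : ℕ) : (Set.range fun z : ℕ → R => walkPos z n).Finite := by
  induction n with
  | zero => exact (Set.finite_singleton 0).subset (by rintro _ ⟨z, rfl⟩; rfl)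
  | succ n ih =>
    refine (ih.image2 (· + ·) (Set.finite_range fun r : R => walkPos (fun _ => r) 1)).subset ?_
    rintro _ ⟨z, rfl⟩
    refine ⟨_, ⟨z, rfl⟩, _, ⟨z n, rfl⟩, ?_⟩
    simp only [walkPos_add z n 1]
    congr 1

theorem finite_displacements (R : Finset (Fin d → ℤ)) (N : ℕ) :
    {p : stepGroup R | ∃ z : ℕ → R, ∃ i ≤ N, ∃ j ≤ N, p = walkPos z i - walkPos z j}.Finite := by
  refine ((Set.finite_Iic N).biUnion fun i _ => (Set.finite_Iic N).biUnion fun j _ =>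
    (finite_range_walkPos (R := R) i).image2 (· - ·) (finite_range_walkPos (R := R) j)).subset ?_
  rintro _ ⟨z, i, hi, j, hj, rfl⟩
  simp only [Set.mem_iUnion]
  exact ⟨i, hi, j, hj, _, ⟨z, rfl⟩, _, ⟨z, rfl⟩, rfl⟩

/-- The differences between two positions of a walk within its first `N` steps. -/
noncomputable def displacements (R : Finset (Fin d → ℤ)) (N : ℕ) : Finset (stepGroup R) :=
  (finite_displacements R N).toFinset

theorem walkPos_sub_walkPos_mem (z : ℕ → R) {N i j : ℕ} (hi : i ≤ N) (hj : j ≤ N) :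
    walkPos z i - walkPos z j ∈ displacements R N :=
  (finite_displacements R N).mem_toFinset.2 ⟨z, i, hi, j, hj, rfl⟩

theorem walkPos_mem (z : ℕ → R) {N i : ℕ} (hi : i ≤ N) : walkPos z i ∈ displacements R N := by
  simpa [walkPos_zero] using walkPos_sub_walkPos_mem z hi (Nat.zero_le N)

theorem zero_mem_displacements [Nonempty R] (N : ℕ) : 0 ∈ displacements R N :=
  walkPos_mem (fun _ => Classical.arbitrary R) (Nat.zero_le N)

theorem displacements_mono {N N' : ℕ} (h : N ≤ N') :
    displacements R N ⊆ displacements R N' := by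
  intro p hp
  obtain ⟨z, i, hi, j, hj, rfl⟩ := (finite_displacements R N).mem_toFinset.1 hp
  exact walkPos_sub_walkPos_mem z (hi.trans h) (hj.trans h)

/-- The first `m` steps of the first sequence followed by the second sequence. -/
def concatSteps (m : ℕ) (p : (ℕ → R) × (ℕ → R)) : ℕ → R :=
  fun i => if i < m then p.1 i else p.2 (i - m)

theorem concatSteps_of_lt {m i : ℕ} (h : i < m) (p : (ℕ → R) × (ℕ → R)) :
    concatSteps m p i = p.1 i := if_pos h

theorem concatSteps_add (m i : ℕ) (p : (ℕ → R) × (ℕ → R)) :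
    concatSteps m p (m + i) = p.2 i := by simp [concatSteps]

theorem measurable_concatSteps (m : ℕ) :
    Measurable (concatSteps m : (ℕ → R) × (ℕ → R) → ℕ → R) := by
  refine measurable_pi_lambda _ fun i => ?_
  unfold concatSteps
  split_ifs
  · exact (measurable_pi_apply i).comp measurable_fst
  · exact (measurable_pi_apply (i - m)).comp measurable_snd

instance [Nonempty R] : IsProbabilityMeasure (stepLaw R) := by
  unfold stepLaw
  infer_instance

/-- The Markov property: the walk restarted at time `m` with independent steps is again the
walk. -/
theorem map_concatSteps [Nonempty R] (m : ℕ) :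
    ((stepLaw R).prod (stepLaw R)).map (concatSteps m) = stepLaw R := by
  refine Measure.eq_infinitePi _ fun s t ht => ?_
  have hpre : concatSteps m ⁻¹' (Set.pi s t) =
      (Set.pi (s.filter (· < m)) t) ×ˢ
        (Set.pi ((s.filter (¬ · < m)).image (· - m)) fun i => t (i + m)) := by
    ext p
    simp only [Set.mem_preimage, Set.mem_pi, Set.mem_prod, Finset.mem_coe, Finset.mem_filter,
      Finset.mem_image]
    constructor
    · intro h
      refine ⟨fun i hi => ?_, ?_⟩
      · have := h i hi.1
        rwa [concatSteps_of_lt hi.2] at this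
      · rintro _ ⟨i, hi, rfl⟩
        have h1 : m + (i - m) = i := by omega
        have := h i hi.1
        rw [← h1, concatSteps_add] at this
        rwa [Nat.add_comm] at this
    · rintro ⟨h1, h2⟩ i hi
      by_cases him : i < m
      · rw [concatSteps_of_lt him]
        exact h1 i ⟨hi, him⟩
      · have h3 := h2 (i - m) ⟨i, ⟨hi, him⟩, rfl⟩
        have h4 : m + (i - m) = i := by omega
        rw [← h4, concatSteps_add, Nat.add_comm]
        exact h3
  rw [Measure.map_apply (measurable_concatSteps m)
    (MeasurableSet.pi s.countable_toSet fun i _ => ht i), hpre, Measure.prod_prod]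
  unfold stepLaw
  rw [Measure.infinitePi_pi _ fun i _ => ht i, Measure.infinitePi_pi _ fun i _ => ht _,
    Finset.prod_image, ← Finset.prod_filter_mul_prod_filter_not s (· < m)]
  · congr 1
    refine Finset.prod_congr rfl fun i hi => ?_
    have : ¬ i < m := (Finset.mem_filter.1 hi).2
    rw [Nat.sub_add_cancel (by omega)]
  · intro i hi j hj hij
    have h1 : ¬ i < m := (Finset.mem_filter.1 (Finset.mem_coe.1 hi)).2
    have h2 : ¬ j < m := (Finset.mem_filter.1 (Finset.mem_coe.1 hj)).2
    simp only at hij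
    omega

theorem stepLaw_real_cylinder [Nonempty R] (z : ℕ → R) (n : ℕ) :
    (stepLaw R).real (Set.pi (Finset.range n) fun i => {z i}) = ((R.card : ℝ)⁻¹) ^ n := by
  unfold stepLaw
  rw [measureReal_def, Measure.infinitePi_pi _ fun i _ => measurableSet_singleton _]
  simp

/-- A function of the environment and the steps which depends on finitely many steps only is
jointly measurable as soon as it is measurable in the environment. -/
theorem measurable_of_dependsOn_initial [Nonempty R] {Ω β : Type*} [MeasurableSpace Ω]
    [MeasurableSpace β] {f : Ω → (ℕ → R) → β} (N : ℕ) (hf : ∀ z, Measurable fun ω => f ω z)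
    (hdep : ∀ ω z z', (∀ i < N, z i = z' i) → f ω z = f ω z') :
    Measurable fun p : Ω × (ℕ → R) => f p.1 p.2 := by
  let ext : (Fin N → R) → ℕ → R := fun s i =>
    if h : i < N then s ⟨i, h⟩ else Classical.arbitrary R
  let res : (ℕ → R) → Fin N → R := fun z i => z i
  have hres : Measurable res := measurable_pi_lambda _ fun i => measurable_pi_apply _
  have h1 : Measurable fun p : Ω × (Fin N → R) => f p.1 (ext p.2) :=
    measurable_from_prod_countable_left fun s => hf (ext s)
  have h2 : (fun p : Ω × (ℕ → R) => f p.1 p.2) =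
      (fun p : Ω × (Fin N → R) => f p.1 (ext p.2)) ∘ fun p => (p.1, res p.2) := by
    funext p
    refine hdep _ _ _ fun i hi => ?_
    simp [ext, res, hi]
  rw [h2]
  exact h1.comp (measurable_fst.prodMk (hres.comp measurable_snd))

theorem measurable_of_dependsOn_initial' [Nonempty R] {β : Type*}
    [MeasurableSpace β] {f : (ℕ → R) → β} (N : ℕ)
    (hdep : ∀ z z', (∀ i < N, z i = z' i) → f z = f z') : Measurable f :=
  (measurable_of_dependsOn_initial (Ω := Unit) (f := fun _ => f) N
    (fun _ => measurable_const) fun _ => hdep).comp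
    (measurable_const (a := ()) |>.prodMk measurable_id)

theorem measurableSet_walkPos_eq [Nonempty R] (n : ℕ) (x : Fin d → ℤ) :
    MeasurableSet {z : ℕ → R | (walkPos z n : Fin d → ℤ) = x} := by
  refine measurableSet_setOfPred.2 (measurable_of_dependsOn_initial' n fun z z' h => ?_)
  rw [walkPos_congr h]

variable {Ω : Type*} {ℓ : ℕ}

/-- The sum of `|g ω z|` over all `z`. -/
def envelope (g : Ω → (Fin ℓ → R) → ℝ) (ω : Ω) : ℝ := ∑ s : Fin ℓ → R, |g ω s|

theorem envelope_nonneg (g : Ω → (Fin ℓ → R) → ℝ) (ω : Ω) : 0 ≤ envelope g ω :=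
  Finset.sum_nonneg fun _ _ => abs_nonneg _

theorem abs_le_envelope (g : Ω → (Fin ℓ → R) → ℝ) (ω : Ω) (s : Fin ℓ → R) :
    |g ω s| ≤ envelope g ω :=
  Finset.single_le_sum (f := fun s => |g ω s|) (fun _ _ => abs_nonneg _) (Finset.mem_univ s)

variable [AddAction (stepGroup R) Ω]

/-! ### Finite-range bounds for the potential and the energy -/

/-- The sum of `f` over the translates of the environment by the displacements of at most
`N` steps. -/
noncomputable def localSum (N : ℕ) (f : Ω → ℝ) (ω : Ω) : ℝ :=
  ∑ p ∈ displacements R N, f (p +ᵥ ω)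

theorem localSum_nonneg {N : ℕ} {f : Ω → ℝ} (hf : ∀ ω, 0 ≤ f ω) (ω : Ω) :
    0 ≤ localSum (R := R) N f ω :=
  Finset.sum_nonneg fun _ _ => hf _

theorem le_localSum {N : ℕ} {f : Ω → ℝ} (hf : ∀ ω, 0 ≤ f ω) {p : stepGroup R}
    (hp : p ∈ displacements R N) (ω : Ω) : f (p +ᵥ ω) ≤ localSum (R := R) N f ω :=
  Finset.single_le_sum (f := fun p : stepGroup R => f (p +ᵥ ω)) (fun _ _ => hf _) hp

theorem le_localSum_self [Nonempty R] {N : ℕ} {f : Ω → ℝ} (hf : ∀ ω, 0 ≤ f ω) (ω : Ω) :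
    f ω ≤ localSum (R := R) N f ω := by
  simpa using le_localSum hf (zero_mem_displacements (R := R) N) ω

theorem measurable_localSum [MeasurableSpace Ω] [MeasurableConstVAdd (stepGroup R) Ω]
    (N : ℕ) {f : Ω → ℝ} (hf : Measurable f) : Measurable (localSum (R := R) N f) :=
  Finset.measurable_fun_sum _ fun p _ => hf.comp (measurable_const_vadd p)

theorem integrable_localSum [MeasurableSpace Ω] [MeasurableConstVAdd (stepGroup R) Ω]
    {ℙ : Measure Ω} [VAddInvariantMeasure (stepGroup R) Ω ℙ]
    (N : ℕ) {f : Ω → ℝ} (hf : Integrable f ℙ) : Integrable (localSum (R := R) N f) ℙ :=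
  integrable_finsetSum _ fun p _ =>
    (measurePreserving_vadd p ℙ).integrable_comp_of_integrable hf

/-- A bound for `|g|` over all environments reached within `N` steps in either time direction. -/
noncomputable def localEnvelope (N : ℕ) (g : Ω → (Fin ℓ → R) → ℝ) : Ω → ℝ :=
  localSum (R := R) N (envelope g)

theorem localEnvelope_nonneg (N : ℕ) (g : Ω → (Fin ℓ → R) → ℝ) (ω : Ω) :
    0 ≤ localEnvelope N g ω :=
  localSum_nonneg (envelope_nonneg g) ω

theorem localEnvelope_mono {N N' : ℕ} (h : N ≤ N') (g : Ω → (Fin ℓ → R) → ℝ) (ω : Ω) :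
    localEnvelope N g ω ≤ localEnvelope N' g ω :=
  Finset.sum_le_sum_of_subset_of_nonneg (displacements_mono h) fun _ _ _ => envelope_nonneg g _

theorem abs_le_localEnvelope {N : ℕ} (g : Ω → (Fin ℓ → R) → ℝ) (ω : Ω) {p : stepGroup R}
    (hp : p ∈ displacements R N) (s : Fin ℓ → R) : |g (p +ᵥ ω) s| ≤ localEnvelope N g ω :=
  (abs_le_envelope g _ s).trans (le_localSum (envelope_nonneg g) hp ω)

theorem measurable_localEnvelope [MeasurableSpace Ω]
    [MeasurableConstVAdd (stepGroup R) Ω] {g : Ω → (Fin ℓ → R) → ℝ}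
    (hg : ∀ s, Measurable fun ω => g ω s) (N : ℕ) : Measurable (localEnvelope N g) :=
  measurable_localSum N (Finset.measurable_fun_sum _ fun s _ => (hg s).abs)

theorem integrable_localEnvelope [MeasurableSpace Ω]
    [MeasurableConstVAdd (stepGroup R) Ω] {ℙ : Measure Ω} [VAddInvariantMeasure (stepGroup R) Ω ℙ]
    {g : Ω → (Fin ℓ → R) → ℝ} (hg : ∀ s, Integrable (fun ω => g ω s) ℙ) (N : ℕ) :
    Integrable (localEnvelope N g) ℙ :=
  integrable_localSum N (integrable_finsetSum _ fun s _ => (hg s).abs)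

theorem pathEnergy_congr (g : Ω → (Fin ℓ → R) → ℝ) (ω : Ω) {n : ℕ} {z z' : ℕ → R}
    (h : ∀ i < n + ℓ, z i = z' i) : pathEnergy g ω n z = pathEnergy g ω n z' := by
  refine Finset.sum_congr rfl fun k hk => ?_
  have hk := Finset.mem_range.1 hk
  rw [walkPos_congr (fun i hi => h i (by omega) : ∀ i < k, z i = z' i)]
  congr 1
  funext j
  exact h _ (by omega)

theorem pathEnergy_add (g : Ω → (Fin ℓ → R) → ℝ) (ω : Ω) (m n : ℕ) (z : ℕ → R) :
    pathEnergy g ω (m + n) z =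
      pathEnergy g ω m z + pathEnergy g (walkPos z m +ᵥ ω) n fun i => z (m + i) := by
  unfold pathEnergy
  rw [Finset.sum_range_add]
  congr 1
  refine Finset.sum_congr rfl fun k _ => ?_
  rw [walkPos_add, add_comm, add_vadd]
  simp only [Nat.add_assoc]

theorem abs_pathEnergy_le (g : Ω → (Fin ℓ → R) → ℝ) (ω : Ω) (n : ℕ) (z : ℕ → R) :
    |pathEnergy g ω n z| ≤ n * localEnvelope n g ω := by
  refine (Finset.abs_sum_le_sum_abs _ _).trans ?_
  refine (Finset.sum_le_sum (g := fun _ => localEnvelope n g ω) fun k hk => ?_).trans (by simp)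
  exact abs_le_localEnvelope g ω (walkPos_mem z (Finset.mem_range.1 hk).le) _

/-- Changing the steps after time `m` affects only the last `ℓ` terms of the energy of the first
`m` steps. -/
theorem abs_pathEnergy_sub_le (g : Ω → (Fin ℓ → R) → ℝ) (ω : Ω) {m : ℕ} {z z' : ℕ → R}
    (h : ∀ i < m, z i = z' i) :
    |pathEnergy g ω m z - pathEnergy g ω m z'| ≤
      2 * ℓ * localEnvelope ℓ g (walkPos z m +ᵥ ω) := by
  set H := localEnvelope ℓ g (walkPos z m +ᵥ ω) with hH
  have hH0 : 0 ≤ H := localEnvelope_nonneg _ _ _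
  unfold pathEnergy
  rw [← Finset.sum_sub_distrib]
  refine (Finset.abs_sum_le_sum_abs _ _).trans ?_
  have hterm : ∀ k ∈ Finset.range m,
      |g (walkPos z k +ᵥ ω) (fun j : Fin ℓ => z (k + j)) -
        g (walkPos z' k +ᵥ ω) (fun j : Fin ℓ => z' (k + j))| ≤
      if m - ℓ ≤ k then 2 * H else 0 := by
    intro k hk
    have hk := Finset.mem_range.1 hk
    have hpos : walkPos z' k = walkPos z k := walkPos_congr fun i hi => (h i (by omega)).symm
    rw [hpos]
    split_ifs with hkm
    · have hmk : walkPos z k +ᵥ ω =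
          (walkPos (fun i => z (k + i)) 0 - walkPos (fun i => z (k + i)) (m - k)) +ᵥ
            (walkPos z m +ᵥ ω) := by
        have h1 := walkPos_add z k (m - k)
        rw [Nat.add_sub_cancel' hk.le] at h1
        rw [← add_vadd, h1, walkPos_zero]
        congr 1
        abel
      have hmem := walkPos_sub_walkPos_mem (fun i => z (k + i)) (N := ℓ) (i := 0) (j := m - k)
        (Nat.zero_le _) (by omega)
      rw [hmk]
      refine (abs_sub _ _).trans ?_
      rw [two_mul]
      exact add_le_add (abs_le_localEnvelope g _ hmem _) (abs_le_localEnvelope g _ hmem _)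
    · have : (fun j : Fin ℓ => z (k + j)) = fun j : Fin ℓ => z' (k + j) := by
        funext j
        exact h _ (by omega)
      rw [this, sub_self, abs_zero]
  refine (Finset.sum_le_sum hterm).trans ?_
  rw [← Finset.sum_filter, Finset.sum_const, nsmul_eq_mul]
  have hcard : ((Finset.range m).filter (m - ℓ ≤ ·)).card ≤ ℓ := by
    have hsub : (Finset.range m).filter (m - ℓ ≤ ·) ⊆ Finset.Ico (m - ℓ) m := by
      intro k
      simp only [Finset.mem_filter, Finset.mem_range, Finset.mem_Ico]
      exact fun hk => ⟨hk.2, hk.1⟩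
    have := Finset.card_le_card hsub
    rw [Nat.card_Ico] at this
    omega
  calc ((((Finset.range m).filter (m - ℓ ≤ ·)).card : ℕ) : ℝ) * (2 * H) ≤ ℓ * (2 * H) :=
        mul_le_mul_of_nonneg_right (by exact_mod_cast hcard) (by linarith)
    _ = 2 * ℓ * H := by ring

/-! ### The partition function -/

/-- The integrand of the partition function. -/
noncomputable def pathWeight (g : Ω → (Fin ℓ → R) → ℝ) (ω : Ω) (n : ℕ) (x : Fin d → ℤ) (z : ℕ → R) : ℝ :=
  {z : ℕ → R | (walkPos z n : Fin d → ℤ) = x}.indicator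
    (fun z => Real.exp (pathEnergy g ω n z)) z

theorem pathWeight_of_eq (g : Ω → (Fin ℓ → R) → ℝ) (ω : Ω) {n : ℕ} {x : Fin d → ℤ}
    {z : ℕ → R} (h : (walkPos z n : Fin d → ℤ) = x) :
    pathWeight g ω n x z = Real.exp (pathEnergy g ω n z) :=
  Set.indicator_of_mem (s := {z : ℕ → R | (walkPos z n : Fin d → ℤ) = x}) h _

theorem pathWeight_of_ne (g : Ω → (Fin ℓ → R) → ℝ) (ω : Ω) {n : ℕ} {x : Fin d → ℤ}
    {z : ℕ → R} (h : (walkPos z n : Fin d → ℤ) ≠ x) : pathWeight g ω n x z = 0 :=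
  Set.indicator_of_notMem (s := {z : ℕ → R | (walkPos z n : Fin d → ℤ) = x}) h _

theorem pathWeight_nonneg (g : Ω → (Fin ℓ → R) → ℝ) (ω : Ω) (n : ℕ) (x : Fin d → ℤ)
    (z : ℕ → R) : 0 ≤ pathWeight g ω n x z :=
  Set.indicator_nonneg (fun _ _ => (Real.exp_pos _).le) z

theorem pathWeight_congr (g : Ω → (Fin ℓ → R) → ℝ) (ω : Ω) {n : ℕ} (x : Fin d → ℤ)
    {z z' : ℕ → R} (h : ∀ i < n + ℓ, z i = z' i) :
    pathWeight g ω n x z = pathWeight g ω n x z' := by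
  have hpos : walkPos z n = walkPos z' n := walkPos_congr fun i hi => h i (by omega)
  by_cases hx : (walkPos z n : Fin d → ℤ) = x
  · rw [pathWeight_of_eq g ω hx, pathWeight_of_eq g ω (by rw [← hpos]; exact hx),
      pathEnergy_congr g ω h]
  · rw [pathWeight_of_ne g ω hx, pathWeight_of_ne g ω (by rw [← hpos]; exact hx)]

theorem pathWeight_le (g : Ω → (Fin ℓ → R) → ℝ) (ω : Ω) (n : ℕ) (x : Fin d → ℤ)
    (z : ℕ → R) : pathWeight g ω n x z ≤ Real.exp (n * localEnvelope n g ω) := by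
  by_cases hx : (walkPos z n : Fin d → ℤ) = x
  · rw [pathWeight_of_eq g ω hx]
    exact Real.exp_le_exp.2 ((le_abs_self _).trans (abs_pathEnergy_le g ω n z))
  · rw [pathWeight_of_ne g ω hx]
    exact (Real.exp_pos _).le

theorem pathWeight_mul_le (g : Ω → (Fin ℓ → R) → ℝ) (ω : Ω) (m n : ℕ) (x y : stepGroup R)
    (p : (ℕ → R) × (ℕ → R)) :
    pathWeight g ω m x p.1 * pathWeight g (x +ᵥ ω) n y p.2 ≤
      Real.exp (2 * ℓ * localEnvelope ℓ g (x +ᵥ ω)) *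
        pathWeight g ω (m + n) (x + y : stepGroup R) (concatSteps m p) := by
  have h0 := mul_nonneg (Real.exp_pos (2 * ℓ * localEnvelope ℓ g (x +ᵥ ω))).le
    (pathWeight_nonneg g ω (m + n) (x + y : stepGroup R) (concatSteps m p))
  by_cases hx : walkPos p.1 m = x
  swap
  · rw [pathWeight_of_ne g ω (fun h => hx (Subtype.ext h)), zero_mul]
    exact h0
  by_cases hy : walkPos p.2 n = y
  swap
  · rw [pathWeight_of_ne g (x +ᵥ ω) (fun h => hy (Subtype.ext h)), mul_zero]
    exact h0
  have h1 : ∀ i < m, concatSteps m p i = p.1 i := fun i hi => concatSteps_of_lt hi p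
  have h2 : (fun i => concatSteps m p (m + i)) = p.2 := funext fun i => concatSteps_add m i p
  have hcm : walkPos (concatSteps m p) m = x := by rw [walkPos_congr h1, hx]
  have hc : walkPos (concatSteps m p) (m + n) = x + y := by rw [walkPos_add, hcm, h2, hy]
  rw [pathWeight_of_eq g ω (by rw [hx]), pathWeight_of_eq g _ (by rw [hy]),
    pathWeight_of_eq g ω (by rw [hc]), ← Real.exp_add, ← Real.exp_add, Real.exp_le_exp,
    pathEnergy_add, hcm, h2]
  have h3 := abs_pathEnergy_sub_le g ω h1
  rw [hcm] at h3
  linarith [(abs_le.1 h3).1]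

variable [Nonempty R]

theorem measurable_pathWeight (g : Ω → (Fin ℓ → R) → ℝ) (ω : Ω) (n : ℕ) (x : Fin d → ℤ) :
    Measurable (pathWeight g ω n x) :=
  measurable_of_dependsOn_initial' (n + ℓ) fun _ _ h => pathWeight_congr g ω x h

theorem integrable_pathWeight (g : Ω → (Fin ℓ → R) → ℝ) (ω : Ω) (n : ℕ) (x : Fin d → ℤ) :
    Integrable (pathWeight g ω n x) (stepLaw R) := by
  refine Integrable.of_bound (measurable_pathWeight g ω n x).aestronglyMeasurable
    (Real.exp (n * localEnvelope n g ω)) (ae_of_all _ fun z => ?_)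
  rw [Real.norm_of_nonneg (pathWeight_nonneg g ω n x z)]
  exact pathWeight_le g ω n x z

theorem partitionFn_eq_integral (g : Ω → (Fin ℓ → R) → ℝ) (ω : Ω) (n : ℕ) (x : Fin d → ℤ) :
    partitionFn g ω n x = ∫ z, pathWeight g ω n x z ∂(stepLaw R) :=
  (integral_indicator (measurableSet_walkPos_eq n x)).symm

theorem partitionFn_mul_le (g : Ω → (Fin ℓ → R) → ℝ) (ω : Ω) (m n : ℕ) (x y : stepGroup R) :
    partitionFn g ω m x * partitionFn g (x +ᵥ ω) n y ≤
      Real.exp (2 * ℓ * localEnvelope ℓ g (x +ᵥ ω)) *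
        partitionFn g ω (m + n) (x + y : stepGroup R) := by
  simp only [partitionFn_eq_integral]
  rw [← integral_prod_mul, ← integral_const_mul]
  conv_rhs => rw [← map_concatSteps m]
  rw [integral_map (measurable_concatSteps m).aemeasurable
    ((measurable_pathWeight g ω _ _).const_mul _).aestronglyMeasurable]
  refine integral_mono ((integrable_pathWeight g ω m x).mul_prod
    (integrable_pathWeight g _ n y)) ?_ fun p => pathWeight_mul_le g ω m n x y p
  have h := ((integrable_pathWeight g ω (m + n) (x + y : stepGroup R)).const_mul
    (Real.exp (2 * ℓ * localEnvelope ℓ g (x +ᵥ ω))))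
  rw [← map_concatSteps m] at h
  exact h.comp_measurable (measurable_concatSteps m)

theorem partitionFn_le (g : Ω → (Fin ℓ → R) → ℝ) (ω : Ω) (n : ℕ) (x : Fin d → ℤ) :
    partitionFn g ω n x ≤ Real.exp (n * localEnvelope n g ω) := by
  rw [partitionFn_eq_integral]
  refine (integral_mono (integrable_pathWeight g ω n x) (integrable_const _)
    fun z => pathWeight_le g ω n x z).trans ?_
  simp

/-- At a point reached by some path the partition function is at least the contribution of that
single path. -/
theorem exp_le_partitionFn (g : Ω → (Fin ℓ → R) → ℝ) (ω : Ω) (n : ℕ) (z : ℕ → R) :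
    Real.exp (-(n * Real.log R.card + n * localEnvelope n g ω)) ≤
      partitionFn g ω n (walkPos z n) := by
  have hcard : (0 : ℝ) < R.card := by
    have h : R.Nonempty := Finset.nonempty_coe_sort.1 ‹_›
    exact_mod_cast h.card_pos
  set C : Set (ℕ → R) := Set.pi (Finset.range n) fun i => {z i} with hC
  have hCm : MeasurableSet C :=
    MeasurableSet.pi (Finset.range n).countable_toSet fun i _ => measurableSet_singleton _
  rw [partitionFn_eq_integral]
  calc Real.exp (-(n * Real.log R.card + n * localEnvelope n g ω))
      = (stepLaw R).real C * Real.exp (-(n * localEnvelope n g ω)) := by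
        rw [hC, stepLaw_real_cylinder, neg_add, Real.exp_add, inv_pow, ← mul_neg,
          ← Real.log_inv, mul_comm (n : ℝ) (Real.log _), Real.exp_mul,
          Real.exp_log (inv_pos.2 hcard), Real.rpow_natCast, inv_pow]
    _ = ∫ w, C.indicator (fun _ => Real.exp (-(n * localEnvelope n g ω))) w ∂(stepLaw R) := by
        rw [integral_indicator_const _ hCm, smul_eq_mul]
    _ ≤ ∫ w, pathWeight g ω n (walkPos z n) w ∂(stepLaw R) := by
        refine integral_mono ((integrable_const _).indicator hCm)
          (integrable_pathWeight g ω n _) fun w => ?_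
        by_cases hw : w ∈ C
        swap
        · simpa [hw] using pathWeight_nonneg g ω n (walkPos z n) w
        have hwz : ∀ i < n, w i = z i := fun i hi => hw i (by simpa using hi)
        rw [Set.indicator_of_mem hw, pathWeight_of_eq g ω (by rw [walkPos_congr hwz]),
          Real.exp_le_exp]
        exact (abs_le.1 (abs_pathEnergy_le g ω n w)).1

theorem partitionFn_pos (g : Ω → (Fin ℓ → R) → ℝ) (ω : Ω) (n : ℕ) (z : ℕ → R) :
    0 < partitionFn g ω n (walkPos z n) :=
  (Real.exp_pos _).trans_le (exp_le_partitionFn g ω n z)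

theorem abs_log_partitionFn_le (g : Ω → (Fin ℓ → R) → ℝ) (ω : Ω) (n : ℕ) (z : ℕ → R) :
    |Real.log (partitionFn g ω n (walkPos z n))| ≤
      n * Real.log R.card + n * localEnvelope n g ω := by
  have h1 := Real.log_le_log (Real.exp_pos _) (exp_le_partitionFn g ω n z)
  have h2 := Real.log_le_log (partitionFn_pos g ω n z) (partitionFn_le g ω n _)
  rw [Real.log_exp] at h1 h2
  have h3 : 0 ≤ n * Real.log R.card :=
    mul_nonneg (Nat.cast_nonneg n) (Real.log_natCast_nonneg _)
  exact abs_le.2 ⟨h1, by linarith⟩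

theorem log_partitionFn_add_le (g : Ω → (Fin ℓ → R) → ℝ) (ω : Ω) (m n : ℕ) (z z' : ℕ → R) :
    Real.log (partitionFn g ω m (walkPos z m)) +
        Real.log (partitionFn g (walkPos z m +ᵥ ω) n (walkPos z' n)) -
          2 * ℓ * localEnvelope ℓ g (walkPos z m +ᵥ ω) ≤
      Real.log (partitionFn g ω (m + n) (walkPos z m + walkPos z' n : stepGroup R)) := by
  have h := partitionFn_mul_le g ω m n (walkPos z m) (walkPos z' n)
  have h1 := partitionFn_pos g ω m z
  have h2 := partitionFn_pos g (walkPos z m +ᵥ ω) n z'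
  have h3 := Real.log_le_log (mul_pos h1 h2) h
  have h4 : 0 < partitionFn g ω (m + n) (walkPos z m + walkPos z' n : stepGroup R) :=
    pos_of_mul_pos_right ((mul_pos h1 h2).trans_le h) (Real.exp_pos _).le
  rw [Real.log_mul h1.ne' h2.ne', Real.log_mul (Real.exp_pos _).ne' h4.ne', Real.log_exp] at h3
  linarith

variable [MeasurableSpace Ω] [MeasurableConstVAdd (stepGroup R) Ω]

theorem measurable_partitionFn {g : Ω → (Fin ℓ → R) → ℝ} (hg : ∀ s, Measurable fun ω => g ω s)
    (n : ℕ) (x : Fin d → ℤ) : Measurable fun ω => partitionFn g ω n x := by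
  simp only [partitionFn_eq_integral]
  have h : Measurable fun p : Ω × (ℕ → R) => pathWeight g p.1 n x p.2 := by
    refine measurable_of_dependsOn_initial (n + ℓ) (fun z => ?_)
      fun ω z z' h => pathWeight_congr g ω x h
    by_cases hx : (walkPos z n : Fin d → ℤ) = x
    · simp only [fun ω => pathWeight_of_eq g ω hx]
      refine Real.measurable_exp.comp ?_
      exact Finset.measurable_fun_sum _ fun k _ => (hg _).comp (measurable_const_vadd _)
    · simp only [fun ω => pathWeight_of_ne g ω hx]
      exact measurable_const
  exact h.stronglyMeasurable.integral_prod_right'.measurable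

end Walk

/-! ### Interpolation between multiples of a period -/

/-- A sequence whose averages converge along the multiples of `k`, and which nearly increases
from one multiple to the points of the next block and on to the next multiple, has convergent
averages. -/
theorem exists_tendsto_of_tendsto_multiples {A e : ℕ → ℝ} {k : ℕ} (hk : 1 ≤ k) {L : EReal}
    (hL : L ≠ ⊥)
    (hlim : Tendsto (fun m : ℕ => (((m : ℝ)⁻¹ * A (m * k) : ℝ) : EReal)) atTop (𝓝 L))
    (he : Tendsto (fun m : ℕ => (m : ℝ)⁻¹ * e m) atTop (𝓝 0))
    (hlow : ∀ n, A (n / k * k) - e (n / k) ≤ A n)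
    (hup : ∀ n, A n - e (n / k) ≤ A ((n / k + 1) * k)) :
    ∃ L' : EReal, L' ≠ ⊥ ∧
      Tendsto (fun n : ℕ => (((n : ℝ)⁻¹ * A n : ℝ) : EReal)) atTop (𝓝 L') := by
  have hk0 : (0 : ℝ) < k := by exact_mod_cast hk
  have hq : Tendsto (fun n : ℕ => n / k) atTop atTop :=
    Nat.tendsto_div_const_atTop (by omega)
  have hr : Tendsto (fun n : ℕ => (n : ℝ)⁻¹ * ((n / k : ℕ) : ℝ)) atTop (𝓝 (k : ℝ)⁻¹) := by
    have h := (tendsto_nat_floor_mul_div_atTop (R := ℝ) (inv_nonneg.2 hk0.le)).comp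
      tendsto_natCast_atTop_atTop
    refine h.congr fun n => ?_
    simp only [Function.comp_apply]
    rw [inv_mul_eq_div, inv_mul_eq_div, Nat.floor_div_eq_div]
  have hr' : Tendsto (fun n : ℕ => (n : ℝ)⁻¹ * ((n / k + 1 : ℕ) : ℝ)) atTop (𝓝 (k : ℝ)⁻¹) := by
    have h := hr.add (tendsto_inv_atTop_nhds_zero_nat (𝕜 := ℝ))
    rw [add_zero] at h
    refine h.congr fun n => ?_
    push_cast
    ring
  have hcancel : ∀ {q : ℕ} (c x : ℝ), 1 ≤ q → c * (q : ℝ) * ((q : ℝ)⁻¹ * x) = c * x := by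
    intro q c x hq
    have : (q : ℝ) ≠ 0 := by exact_mod_cast (by omega : q ≠ 0)
    field_simp
  have hq1 : ∀ᶠ n : ℕ in atTop, 1 ≤ n / k := hq.eventually_ge_atTop 1
  have hlow' : ∀ᶠ n : ℕ in atTop, (n : ℝ)⁻¹ * ((n / k : ℕ) : ℝ) *
      (((n / k : ℕ) : ℝ)⁻¹ * A (n / k * k) - ((n / k : ℕ) : ℝ)⁻¹ * e (n / k)) ≤
        (n : ℝ)⁻¹ * A n := by
    filter_upwards [hq1] with n hn
    rw [← mul_sub, hcancel _ _ hn]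
    exact mul_le_mul_of_nonneg_left (hlow n) (by positivity)
  have hup' : ∀ᶠ n : ℕ in atTop, (n : ℝ)⁻¹ * A n ≤
      (n : ℝ)⁻¹ * ((n / k + 1 : ℕ) : ℝ) * (((n / k + 1 : ℕ) : ℝ)⁻¹ * A ((n / k + 1) * k)) +
      (n : ℝ)⁻¹ * ((n / k : ℕ) : ℝ) * (((n / k : ℕ) : ℝ)⁻¹ * e (n / k)) := by
    filter_upwards [hq1] with n hn
    rw [hcancel _ _ hn, hcancel _ _ (by omega), ← mul_add]
    exact mul_le_mul_of_nonneg_left (by linarith [hup n]) (by positivity)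
  have heq := he.comp hq
  induction L with
  | bot => exact absurd rfl hL
  | coe a =>
    have hA : Tendsto (fun m : ℕ => (m : ℝ)⁻¹ * A (m * k)) atTop (𝓝 a) := EReal.tendsto_coe.1 hlim
    refine ⟨((k : ℝ)⁻¹ * a : ℝ), EReal.coe_ne_bot _, EReal.tendsto_coe.2 ?_⟩
    have h1 := hr.mul ((hA.comp hq).sub heq)
    have h2 := (hr'.mul (hA.comp ((tendsto_add_atTop_nat 1).comp hq))).add (hr.mul heq)
    rw [sub_zero] at h1
    rw [mul_zero, add_zero] at h2
    exact tendsto_of_tendsto_of_tendsto_of_le_of_le' h1 h2 hlow' hup'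
  | top =>
    have hA : Tendsto (fun m : ℕ => (m : ℝ)⁻¹ * A (m * k)) atTop atTop :=
      EReal.tendsto_coe_nhds_top_iff.1 hlim
    refine ⟨⊤, bot_ne_top.symm, EReal.tendsto_coe_nhds_top_iff.2 ?_⟩
    have h2 : Tendsto (fun n : ℕ => (n : ℝ)⁻¹ * ((n / k : ℕ) : ℝ) *
        (((n / k : ℕ) : ℝ)⁻¹ * A (n / k * k) - ((n / k : ℕ) : ℝ)⁻¹ * e (n / k))) atTop atTop :=
      hr.pos_mul_atTop (inv_pos.2 hk0)
        (((hA.comp hq).atTop_add heq.neg).congr fun n => (sub_eq_add_neg _ _).symm)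
    exact tendsto_atTop_mono' _ hlow' h2

/-! ### Limits along paths -/

section Limits

variable {d : ℕ} {R : Finset (Fin d → ℤ)} {Ω : Type*} [AddAction (stepGroup R) Ω] {ℓ : ℕ}

theorem iterate_vadd (v : stepGroup R) (m : ℕ) (ω : Ω) :
    (fun ω : Ω => v +ᵥ ω)^[m] ω = m • v +ᵥ ω :=
  congrFun (vadd_iterate v m) ω

/-- The loss in prolonging paths by at most `k` steps from the position at which the environment
is seen as `ω`. -/
noncomputable def prolongationCost (k : ℕ) (g : Ω → (Fin ℓ → R) → ℝ) (ω : Ω) : ℝ :=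
  2 * ℓ * localEnvelope ℓ g ω + (k * Real.log R.card + k * localEnvelope k g ω)

theorem prolongationCost_nonneg (k : ℕ) (g : Ω → (Fin ℓ → R) → ℝ) (ω : Ω) :
    0 ≤ prolongationCost k g ω := by
  have h1 := localEnvelope_nonneg ℓ g ω
  have h2 := localEnvelope_nonneg k g ω
  have h3 := Real.log_natCast_nonneg R.card
  unfold prolongationCost
  positivity

theorem log_partitionFn_sub_le [Nonempty R] (g : Ω → (Fin ℓ → R) → ℝ) (ω : Ω) (z : ℕ → R)
    (m : ℕ) {r k : ℕ} (hrk : r ≤ k) :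
    Real.log (partitionFn g ω m (walkPos z m)) - prolongationCost k g (walkPos z m +ᵥ ω) ≤
      Real.log (partitionFn g ω (m + r) (walkPos z (m + r))) := by
  have h1 := log_partitionFn_add_le g ω m r z fun i => z (m + i)
  rw [← walkPos_add] at h1
  have h2 := (abs_le.1 (abs_log_partitionFn_le g (walkPos z m +ᵥ ω) r fun i => z (m + i))).1
  have hrk' : (r : ℝ) ≤ k := by exact_mod_cast hrk
  have h3 : (r : ℝ) * Real.log R.card ≤ k * Real.log R.card :=
    mul_le_mul_of_nonneg_right hrk' (Real.log_natCast_nonneg _)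
  have h4 : (r : ℝ) * localEnvelope r g (walkPos z m +ᵥ ω) ≤
      k * localEnvelope k g (walkPos z m +ᵥ ω) :=
    mul_le_mul hrk' (localEnvelope_mono hrk g _) (localEnvelope_nonneg _ _ _) (Nat.cast_nonneg _)
  unfold prolongationCost
  linarith

variable [MeasurableSpace Ω] [MeasurableConstVAdd (stepGroup R) Ω]

theorem measurable_prolongationCost {g : Ω → (Fin ℓ → R) → ℝ}
    (hg : ∀ s, Measurable fun ω => g ω s) (k : ℕ) : Measurable (prolongationCost k g) :=
  ((measurable_localEnvelope hg ℓ).const_mul _).add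
    (((measurable_localEnvelope hg k).const_mul _).const_add _)

variable {ℙ : Measure Ω} [IsProbabilityMeasure ℙ] [VAddInvariantMeasure (stepGroup R) Ω ℙ]

theorem integrable_prolongationCost {g : Ω → (Fin ℓ → R) → ℝ}
    (hg : ∀ s, Integrable (fun ω => g ω s) ℙ) (k : ℕ) : Integrable (prolongationCost k g) ℙ :=
  ((integrable_localEnvelope hg ℓ).const_mul _).add
    ((integrable_const _).add ((integrable_localEnvelope hg k).const_mul _))

theorem ae_tendsto_inv_mul_vadd {f : Ω → ℝ} (hfm : Measurable f) (hf : Integrable f ℙ)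
    (hf0 : ∀ ω, 0 ≤ f ω) (v : stepGroup R) :
    ∀ᵐ ω ∂ℙ, Tendsto (fun m : ℕ => (m : ℝ)⁻¹ * f (m • v +ᵥ ω)) atTop (𝓝 0) := by
  filter_upwards [ae_tendsto_inv_mul_iterate (measurePreserving_vadd v ℙ) hfm hf hf0] with ω hω
  simpa only [iterate_vadd] using hω

variable [Nonempty R]

/-- Convergence along the multiples of `k`. Up to the boundary cost at the endpoint, the
logarithm of the partition function is superadditive under the shift by `v`. -/
theorem ae_exists_tendsto_multiples {g : Ω → (Fin ℓ → R) → ℝ}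
    (hgm : ∀ s, Measurable fun ω => g ω s) (hg : ∀ s, Integrable (fun ω => g ω s) ℙ)
    (k : ℕ) (v : stepGroup R) (z : ℕ → R) (hz : ∀ m, walkPos z (m * k) = m • v) :
    ∀ᵐ ω ∂ℙ, ∃ L : EReal, L ≠ ⊥ ∧
      Tendsto (fun m : ℕ => (((m : ℝ)⁻¹ *
        Real.log (partitionFn g ω (m * k) (m • v : stepGroup R)) : ℝ) : EReal)) atTop (𝓝 L) := by
  set F : Ω → ℝ := fun ω => 2 * ℓ * localEnvelope ℓ g ω with hF
  have hFm : Measurable F := (measurable_localEnvelope hgm ℓ).const_mul _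
  have hFi : Integrable F ℙ := (integrable_localEnvelope hg ℓ).const_mul _
  have hF0 : ∀ ω, 0 ≤ F ω := fun ω =>
    mul_nonneg (by positivity) (localEnvelope_nonneg ℓ g ω)
  set a : ℕ → Ω → ℝ := fun m ω =>
    Real.log (partitionFn g ω (m * k) (m • v : stepGroup R)) - F (m • v +ᵥ ω) with ha_def
  have ha : SuperadditiveAlong (fun ω : Ω => v +ᵥ ω) a := by
    intro m n _ _ ω
    have h := log_partitionFn_add_le g ω (m * k) (n * k) z z
    rw [hz, hz, ← add_nsmul, ← Nat.add_mul] at h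
    simp only [ha_def, iterate_vadd, ← add_vadd, ← add_nsmul, Nat.add_comm n m]
    linarith
  have ham : ∀ m, Measurable (a m) := fun m =>
    (Real.measurable_log.comp (measurable_partitionFn hgm _ _)).sub
      (hFm.comp (measurable_const_vadd _))
  have hai : Integrable (a 1) ℙ := by
    refine Integrable.sub ?_ ((measurePreserving_vadd (1 • v) ℙ).integrable_comp_of_integrable hFi)
    refine Integrable.mono' ((integrable_const (((1 * k : ℕ) : ℝ) * Real.log R.card)).add
      ((integrable_localEnvelope hg (1 * k)).const_mul ((1 * k : ℕ) : ℝ)))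
      (Real.measurable_log.comp (measurable_partitionFn hgm _ _)).aestronglyMeasurable
      (ae_of_all _ fun ω => ?_)
    rw [← hz 1]
    exact abs_log_partitionFn_le g ω (1 * k) z
  filter_upwards [ha.ae_exists_tendsto (measurePreserving_vadd v ℙ) ham hai,
    ae_tendsto_inv_mul_vadd hFm hFi hF0 v] with ω ⟨L, hL, hlim⟩ hFlim
  refine ⟨L + ((0 : ℝ) : EReal), by simpa using hL, ?_⟩
  refine (tendsto_coe_add_of_tendsto hlim hFlim).congr fun m => ?_
  simp only [ha_def]
  congr 1
  ring

/-- Convergence along a whole path whose positions at the multiples of `k` are the multiples of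
a fixed vector, almost surely for all such paths. -/
theorem ae_exists_tendsto_path {g : Ω → (Fin ℓ → R) → ℝ}
    (hgm : ∀ s, Measurable fun ω => g ω s) (hg : ∀ s, Integrable (fun ω => g ω s) ℙ) :
    ∀ᵐ ω ∂ℙ, ∀ (k : ℕ) (v : stepGroup R) (z : ℕ → R), 1 ≤ k →
      (∀ m, walkPos z (m * k) = m • v) → ∃ L : EReal, L ≠ ⊥ ∧
        Tendsto (fun n : ℕ => (((n : ℝ)⁻¹ *
          Real.log (partitionFn g ω n (walkPos z n)) : ℝ) : EReal)) atTop (𝓝 L) := by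
  have hlim : ∀ᵐ ω ∂ℙ, ∀ (k : ℕ) (v : stepGroup R),
      (∃ z : ℕ → R, ∀ m, walkPos z (m * k) = m • v) → ∃ L : EReal, L ≠ ⊥ ∧
        Tendsto (fun m : ℕ => (((m : ℝ)⁻¹ *
          Real.log (partitionFn g ω (m * k) (m • v : stepGroup R)) : ℝ) : EReal)) atTop (𝓝 L) := by
    refine ae_all_iff.2 fun k => ae_all_iff.2 fun v => ?_
    by_cases h : ∃ z : ℕ → R, ∀ m, walkPos z (m * k) = m • v
    · obtain ⟨z, hz⟩ := h
      filter_upwards [ae_exists_tendsto_multiples hgm hg k v z hz] with ω hω _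
      exact hω
    · exact ae_of_all _ fun ω h' => absurd h' h
  have herr : ∀ᵐ ω ∂ℙ, ∀ (k : ℕ) (v : stepGroup R),
      Tendsto (fun m : ℕ => (m : ℝ)⁻¹ *
        localSum (R := R) k (prolongationCost k g) (m • v +ᵥ ω)) atTop (𝓝 0) :=
    ae_all_iff.2 fun k => ae_all_iff.2 fun v =>
      ae_tendsto_inv_mul_vadd (measurable_localSum k (measurable_prolongationCost hgm k))
        (integrable_localSum k (integrable_prolongationCost hg k))
        (localSum_nonneg (prolongationCost_nonneg k g)) v
  filter_upwards [hlim, herr] with ω hω1 hω2 k v z hk hz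
  obtain ⟨L, hL, hLlim⟩ := hω1 k v ⟨z, hz⟩
  refine exists_tendsto_of_tendsto_multiples
    (A := fun n => Real.log (partitionFn g ω n (walkPos z n)))
    (e := fun m => localSum (R := R) k (prolongationCost k g) (m • v +ᵥ ω)) hk hL ?_ (hω2 k v)
    (fun n => ?_) fun n => ?_
  · simpa only [hz] using hLlim
  · have hr : n % k ≤ k := (Nat.mod_lt n (by omega)).le
    have h1 := log_partitionFn_sub_le g ω z (n / k * k) hr
    rw [Nat.div_add_mod'] at h1
    have h2 := le_localSum_self (R := R) (N := k) (prolongationCost_nonneg k g)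
      (walkPos z (n / k * k) +ᵥ ω)
    rw [hz] at h1 h2
    simp only [hz]
    linarith
  · have hmod := Nat.div_add_mod' n k
    have hlt := Nat.mod_lt n (show 0 < k by omega)
    have hn : n + (k - n % k) = (n / k + 1) * k := by
      rw [Nat.add_mul]
      omega
    have h1 := log_partitionFn_sub_le g ω z n (Nat.sub_le k (n % k))
    rw [hn] at h1
    have h2 := walkPos_add z (n / k * k) (n % k)
    rw [hmod, hz, add_comm] at h2
    have h3 := le_localSum (R := R) (prolongationCost_nonneg k g)
      (walkPos_mem (fun i => z (n / k * k + i)) hlt.le) ((n / k) • v +ᵥ ω)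
    rw [← add_vadd, ← h2] at h3
    linarith

end Limits

/-! ### Paths with rational direction -/

section RationalPath

variable {d : ℕ} {R : Finset (Fin d → ℤ)}

theorem IsRationalPath.exists_steps {ξ : Fin d → ℚ} {y : ℕ → Fin d → ℤ}
    (hy : IsRationalPath R ξ y) :
    ∃ (k : ℕ) (v : stepGroup R) (z : ℕ → R), 1 ≤ k ∧ (∀ m, walkPos z (m * k) = m • v) ∧
      ∀ n, (walkPos z n : Fin d → ℤ) = y n := by
  obtain ⟨hstep, k, hk, hpos⟩ := hy
  have hy0 : y 0 = 0 := by
    funext i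
    have h := hpos 0 i
    rw [Nat.zero_mul] at h
    simpa using h
  set z : ℕ → R := fun n => ⟨y (n + 1) - y n, hstep n⟩ with hz_def
  have hz : ∀ n, (walkPos z n : Fin d → ℤ) = y n := by
    intro n
    have h : (walkPos z n : Fin d → ℤ) = ∑ i ∈ Finset.range n, (y (i + 1) - y i) := by
      unfold walkPos
      exact AddSubmonoidClass.coe_finsetSum _ _
    rw [h, Finset.sum_range_sub, hy0, sub_zero]
  refine ⟨k, walkPos z k, z, hk, fun m => Subtype.ext ?_, hz⟩
  rw [hz, AddSubgroup.coe_nsmul, hz]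
  funext i
  have h1 := hpos m i
  have h2 := hpos 1 i
  rw [Nat.one_mul] at h2
  have h3 : (y (m * k) i : ℚ) = ((m • y k) i : ℤ) := by
    rw [h1, Pi.smul_apply, nsmul_eq_mul]
    push_cast
    rw [h2]
    push_cast
    ring
  exact_mod_cast h3

/-- Two paths with the same direction `ξ` meet at all multiples of a common period. -/
theorem IsRationalPath.exists_common_period {ξ : Fin d → ℚ} {y y' : ℕ → Fin d → ℤ}
    (hy : IsRationalPath R ξ y) (hy' : IsRationalPath R ξ y') :
    ∃ k : ℕ, 1 ≤ k ∧ ∀ m, y (m * k) = y' (m * k) := by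
  obtain ⟨-, k, hk, h⟩ := hy
  obtain ⟨-, k', hk', h'⟩ := hy'
  refine ⟨k * k', Nat.mul_pos hk hk', fun m => ?_⟩
  funext i
  have h1 := h (m * k') i
  have h2 := h' (m * k) i
  rw [show m * k' * k = m * (k * k') by ring] at h1
  rw [show m * k * k' = m * (k * k') by ring] at h2
  have h3 : (y (m * (k * k')) i : ℚ) = y' (m * (k * k')) i := by
    rw [h1, h2]
    push_cast
    ring
  exact_mod_cast h3

end RationalPath

/-- The partition functions of two potentials that agree along the orbit of `ω` coincide. -/
theorem partitionFn_congr {d : ℕ} {R : Finset (Fin d → ℤ)} [Nonempty R] {Ω : Type*}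
    [AddAction (stepGroup R) Ω] {ℓ : ℕ} {g g' : Ω → (Fin ℓ → R) → ℝ} {ω : Ω}
    (h : ∀ (p : stepGroup R) (s : Fin ℓ → R), g (p +ᵥ ω) s = g' (p +ᵥ ω) s) (n : ℕ)
    (x : Fin d → ℤ) : partitionFn g ω n x = partitionFn g' ω n x := by
  simp only [partitionFn, pathEnergy, h]

theorem mainTheorem11 {d : ℕ} (R : Finset (Fin d → ℤ)) [Nonempty R]
    {Ω : Type*} [MeasurableSpace Ω] [AddAction (stepGroup R) Ω]
    [MeasurableConstVAdd (stepGroup R) Ω]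
    (ℙ : Measure Ω) [IsProbabilityMeasure ℙ] [VAddInvariantMeasure (stepGroup R) Ω ℙ]
    (ℓ : ℕ) (g : Ω → (Fin ℓ → R) → ℝ)
    (hg : ∀ z : Fin ℓ → R, Integrable (fun ω => g ω z) ℙ) :
    ∀ᵐ ω ∂ℙ, ∀ ξ : Fin d → ℚ, (fun i => (ξ i : ℝ)) ∈ stepHull R →
      ∃ L : EReal, L ≠ ⊥ ∧
        ∀ y : ℕ → Fin d → ℤ, IsRationalPath R ξ y →
          Tendsto
            (fun n : ℕ => (((n : ℝ)⁻¹ * Real.log (partitionFn g ω n (y n)) : ℝ) : EReal))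
            atTop (𝓝 L) := by
  -- The potential is replaced by a version measurable in the environment. As `stepGroup R` is
  -- countable, almost surely this changes nothing on the orbit of `ω`.
  set g' : Ω → (Fin ℓ → R) → ℝ := fun ω s => (hg s).aestronglyMeasurable.mk _ ω with hg'_def
  have hg'm : ∀ s, Measurable fun ω => g' ω s := fun s =>
    (hg s).aestronglyMeasurable.stronglyMeasurable_mk.measurable
  have hgg' : ∀ s, (fun ω => g ω s) =ᵐ[ℙ] fun ω => g' ω s := fun s =>
    (hg s).aestronglyMeasurable.ae_eq_mk
  have hg'i : ∀ s, Integrable (fun ω => g' ω s) ℙ := fun s => (hg s).congr (hgg' s)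
  have horbit : ∀ᵐ ω ∂ℙ, ∀ (p : stepGroup R) (s : Fin ℓ → R),
      g (p +ᵥ ω) s = g' (p +ᵥ ω) s :=
    ae_all_iff.2 fun p => ae_all_iff.2 fun s =>
      (measurePreserving_vadd p ℙ).quasiMeasurePreserving.ae (hgg' s)
  filter_upwards [horbit, ae_exists_tendsto_path hg'm hg'i] with ω hω1 hω2 ξ _
  have hpath : ∀ y : ℕ → Fin d → ℤ, IsRationalPath R ξ y → ∃ L : EReal, L ≠ ⊥ ∧
      Tendsto (fun n : ℕ => (((n : ℝ)⁻¹ * Real.log (partitionFn g ω n (y n)) : ℝ) : EReal))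
        atTop (𝓝 L) := by
    intro y hy
    obtain ⟨k, v, z, hk, hz, hzy⟩ := hy.exists_steps
    simpa only [hzy, partitionFn_congr hω1] using hω2 k v z hk hz
  by_cases hex : ∃ y, IsRationalPath R ξ y
  · obtain ⟨y₀, hy₀⟩ := hex
    obtain ⟨L, hL, hlim⟩ := hpath y₀ hy₀
    refine ⟨L, hL, fun y hy => ?_⟩
    obtain ⟨L', -, hlim'⟩ := hpath y hy
    obtain ⟨k, hk, hyy⟩ := hy₀.exists_common_period hy
    have hmul : Tendsto (fun m : ℕ => m * k) atTop atTop :=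
      tendsto_id.atTop_mul_const' (by omega)
    have h1 := hlim.comp hmul
    have h2 := hlim'.comp hmul
    simp only [Function.comp_def, hyy] at h1 h2
    rwa [tendsto_nhds_unique h1 h2]
  · exact ⟨0, EReal.zero_ne_bot, fun y hy => absurd ⟨y, hy⟩ hex⟩
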